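/- Let $|LLT\rangle=|0\rangle(|01\rangle+|22\rangle)+|1\rangle(|00\rangle+|12\rangle)\in\mathbb C^2\otimes\mathbb C^3\otimes\mathbb C^3$. For an invertible complex $3\times3$ matrix $b=(b_{\alpha\beta})_{0\le\alpha,\beta\le2}$ let $A_b^0,A_b^1$ be the $3\times 3$ matrices with $(\mathbb 1\otimes b\otimes\mathbb 1)|LLT\rangle=\sum_{i,\alpha,\beta}(A_b^i)_{\alpha\beta}|i\rangle|\alpha\rangle|\beta\rangle$, let $$\Psi_b^{(N)}=\sum_{i_1,\dots,i_N\in\{0,1\}}\operatorname{tr}\bigl(A_b^{i_1}\cdots A_b^{i_N}\bigr)\,|i_1\dots i_N\rangle\in(\mathbb C^2)^{\otimes N}$$ be the translationally invariant matrix product state it generates on $N$ qubits, and put $$T_b=\begin{pmatrix}b_{02}-b_{00}b_{22}& b_{10}b_{22}-b_{12}\\ b_{01}-b_{00}b_{21}& b_{10}b_{21}-b_{11}\end{pmatrix},\qquad v_b=\begin{pmatrix}b_{10}+b_{22}\\ b_{00}+b_{21}\end{pmatrix}.$$ The tensor $A_b$ is called injective at length $L$ if the map $X\mapsto\bigl(\operatorname{tr}(XA_b^{j_1}\cdots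 A_b^{j_L})\bigr)_{j\in\{0,1\}^L}$ on $\mathbb C^{3\times3}$ is injective, and normal if it is injective at some length. Two $N$-qubit states $\psi,\phi$ are SLOCC equivalent if $\psi=(g_1\otimes\cdots\otimes g_N)\phi$ for some $g_1,\dots,g_N\in GL(2,\mathbb C)$, and related by a global operation if $\psi\propto g^{\otimes N}\phi$ with a non-zero factor for some $g\in GL(2,\mathbb C)$. **Theorem.** Let $b,c$ be invertible complex $3\times 3$ matrices with $b_{20}=c_{20}=1$ and $v_b,v_c\neq0$. Then $A_b$ and $A_c$ are normal. Let $L$ be any length at which both are injective. Then for every $N\ge 2L+1$ the following are equivalent: 1. $\Psi_b^{(N)}$ and $\Psi_c^{(N)}$ are SLOCC equivalent; 2. $\Psi_b^{(N)}$ and $\Psi_c^{(N)}$ are related by a global operation; 3. there are $g\in SL(2,\mathbb C)$ and $t\in\mathbb C\setminus\{0\}$ with $$v_b=t\,g v_c\qquad\text{and}\qquad T_b=t^2\,g\,T_c\,g^{-1}.$$ Moreover, for every $g$ as in 3. one has $\Psi_b^{(N)}\propto g^{\otimes N}\Psi_c^{(N)}$ with a non-zero factor. If $v_b^Tv_b\neq0$,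 then for each $g\in SL(2,\mathbb C)$ the condition in 3. (existence of such a $t$) says precisely that $$v_b\propto g v_c\quad\text{and}\quad T_b=\frac{v_b^Tv_b}{(gv_c)^Tgv_c}\;g\,T_c\,g^{-1}.$$ In particular, SLOCC equivalence of $\Psi_b^{(N)}$ and $\Psi_c^{(N)}$ does not depend on $N$: if it holds for one $N\ge2L+1$, it holds for all of them. -/

import Mathlib

open scoped Matrix

noncomputable section

/-- A translationally invariant tensor with physical dimension 2 and bond dimension 3.
`A i α β` is the coefficient of `|i⟩|α⟩|β⟩` in the three-partite fiducial state. -/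
abbrev MPSTensor : Type := Fin 2 → Matrix (Fin 3) (Fin 3) ℂ

/-- State vectors of `N` qubits, given by their amplitudes in the standard basis. -/
abbrev QubitState (N : ℕ) : Type := (Fin N → Fin 2) → ℂ

/-- `|LLT⟩ = |0⟩(|01⟩ + |22⟩) + |1⟩(|00⟩ + |12⟩)`. -/
def tensorLLT : MPSTensor :=
  ![!![0, 1, 0; 0, 0, 0; 0, 0, 1], !![1, 0, 0; 0, 0, 1; 0, 0, 0]]

/-- The tensor of `(𝟙 ⊗ b ⊗ 𝟙)|LLT⟩`; its `(i, α, β)` entry is `∑ α', b α α' * LLT i α' β`. -/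
def fiducial (b : Matrix (Fin 3) (Fin 3) ℂ) : MPSTensor := fun i => b * tensorLLT i

/-- The product `A^{i₀} A^{i₁} ⋯ A^{i_{N-1}}`. -/
def wordProd (A : MPSTensor) {N : ℕ} (i : Fin N → Fin 2) : Matrix (Fin 3) (Fin 3) ℂ :=
  (List.ofFn fun k => A (i k)).prod

/-- The matrix product state on `N` sites generated by the tensor `A`. -/
def mps (A : MPSTensor) (N : ℕ) : QubitState N := fun i => (wordProd A i).trace

/-- The contraction of `L` copies of `A` is injective: the map
`X ↦ ∑_j tr(X A^{j₁} ⋯ A^{j_L}) |j₁ … j_L⟩` is injective. -/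
def InjectiveAt (A : MPSTensor) (L : ℕ) : Prop :=
  Function.Injective fun (X : Matrix (Fin 3) (Fin 3) ℂ) (j : Fin L → Fin 2) =>
    (X * wordProd A j).trace

/-- Normality of a tensor. -/
def IsNormalTensor (A : MPSTensor) : Prop := ∃ L : ℕ, InjectiveAt A L

/-- The action of the product operator `g₀ ⊗ g₁ ⊗ ⋯ ⊗ g_{N-1}` on an `N`-qubit state. -/
def localOp {N : ℕ} (g : Fin N → Matrix (Fin 2) (Fin 2) ℂ) (ψ : QubitState N) :
    QubitState N :=
  fun i => ∑ j : Fin N → Fin 2, (∏ k, g k (i k) (j k)) * ψ j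

/-- SLOCC equivalence: the states are related by an invertible local operator. -/
def SLOCCEquivalent {N : ℕ} (ψ φ : QubitState N) : Prop :=
  ∃ g : Fin N → GL (Fin 2) ℂ, ψ = localOp (fun k => (g k : Matrix (Fin 2) (Fin 2) ℂ)) φ

/-- `ψ` is, up to a non-zero scalar, the image of `φ` under `g ⊗ g ⊗ ⋯ ⊗ g`. -/
def RelatedByGlobal {N : ℕ} (g : Matrix (Fin 2) (Fin 2) ℂ) (ψ φ : QubitState N) : Prop :=
  ∃ μ : ℂ, μ ≠ 0 ∧ ψ = μ • localOp (fun _ => g) φ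

/-- The states are related by an invertible global operation. -/
def GloballyEquivalent {N : ℕ} (ψ φ : QubitState N) : Prop :=
  ∃ g : GL (Fin 2) ℂ, RelatedByGlobal (g : Matrix (Fin 2) (Fin 2) ℂ) ψ φ

/-- The matrix `T_b`. -/
def matT (b : Matrix (Fin 3) (Fin 3) ℂ) : Matrix (Fin 2) (Fin 2) ℂ :=
  !![b 0 2 - b 0 0 * b 2 2, b 1 0 * b 2 2 - b 1 2;
     b 0 1 - b 0 0 * b 2 1, b 1 0 * b 2 1 - b 1 1]

/-- The vector `v_b`. -/
def vecV (b : Matrix (Fin 3) (Fin 3) ℂ) : Fin 2 → ℂ :=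
  ![b 1 0 + b 2 2, b 0 0 + b 2 1]

/-- `v_b = t g v_c` and `T_b = t² g T_c g⁻¹` for some non-zero `t`. -/
def ParamRelated (b c : Matrix (Fin 3) (Fin 3) ℂ) (g : Matrix (Fin 2) (Fin 2) ℂ) : Prop :=
  ∃ t : ℂ, t ≠ 0 ∧ vecV b = t • (g *ᵥ vecV c) ∧ matT b = t ^ 2 • (g * matT c * g⁻¹)

/-- `v_b ∝ g v_c` and `T_b = (v_bᵀ v_b) / ((g v_c)ᵀ g v_c) g T_c g⁻¹`. The quotient is meaningful
when `v_bᵀ v_b ≠ 0`, for then `v_b ∝ g v_c` makes its denominator non-zero. -/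
def RatioRelated (b c : Matrix (Fin 3) (Fin 3) ℂ) (g : Matrix (Fin 2) (Fin 2) ℂ) : Prop :=
  (∃ t : ℂ, t ≠ 0 ∧ vecV b = t • (g *ᵥ vecV c)) ∧
    matT b = ((vecV b ⬝ᵥ vecV b) / ((g *ᵥ vecV c) ⬝ᵥ (g *ᵥ vecV c))) • (g * matT c * g⁻¹)

end

/-! Two states that agree on a ring of injective blocks come from tensors that agree up to an
invertible gauge on each bond (`exists_gauge`). For a SLOCC equivalence this gives, at each site, `∑
j, g k i j • fiducial c j` times `Z (k + 1)` proportional to `Z k * fiducial b i`.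

As a matrix pencil, LLT is the sum of the Kronecker blocks L₁ and L₁ᵀ. Its symmetries are known:
every `g` lifts to the bonds (`sum_smul_tensorLLT`), and the remaining freedom has four parameters
`a, d, p, q` (`tensorLLT_intertwiner`). Eliminating the gauges between neighbouring sites leaves,
for the rescaled operators `f k = (d k / a k) • g k`, the relations `f k v_c = v_b` and `f k * U_c *
(f (k + 1))ᵀ = U_b`, where `U = bilinT` is `T` read as a bilinear form (`gauge_bilinT`,
`gauge_vecV`).

The operators may still vary from site to site. Fixing the vector makes them affine, and a periodic
chain of such congruences can be replaced by a single one (`exists_congruence_of_cyclic`); dividing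
by a square root of its determinant gives `g` and `t`. Conversely, these data determine a gauge that
is the same on all bonds (`exists_gauge_of_paramRelated`).

Normality holds at length four: a two-site block is, up to fixed invertible factors, `E i j ⊕ U i
j`, and joining two such blocks tests every matrix entry because `det U` and `v` are non-zero. -/

/-! ### Site-dependent matrix products and block maps -/

section FundamentalTheorem

variable {ι n K : Type*} [Fintype n] [DecidableEq n] [Field K]

/-- The product `B k i₀ * B (k+1) i₁ * ⋯` along a word, for a site-dependent family of tensors. -/
def siteProd (B : ℕ → ι → Matrix n n K) : ℕ → List ι → Matrix n n K
  | _, [] => 1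
  | k, i :: w => B k i * siteProd B (k + 1) w

@[simp] theorem siteProd_nil (B : ℕ → ι → Matrix n n K) (k : ℕ) : siteProd B k [] = 1 := rfl

@[simp] theorem siteProd_cons (B : ℕ → ι → Matrix n n K) (k : ℕ) (i : ι) (w : List ι) :
    siteProd B k (i :: w) = B k i * siteProd B (k + 1) w := rfl

theorem siteProd_append (B : ℕ → ι → Matrix n n K) (k : ℕ) (u w : List ι) :
    siteProd B k (u ++ w) = siteProd B k u * siteProd B (k + u.length) w := by
  induction u generalizing k with
  | nil => simp
  | cons i u ih => simp [ih, mul_assoc, add_assoc, add_comm 1]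

theorem siteProd_periodic {B : ℕ → ι → Matrix n n K} {N : ℕ} (hB : ∀ k, B (k + N) = B k)
    (k : ℕ) (w : List ι) : siteProd B (k + N) w = siteProd B k w := by
  induction w generalizing k with
  | nil => rfl
  | cons i w ih => rw [siteProd_cons, siteProd_cons, hB, add_right_comm, ih]

/-- The products along words of length `m` starting at any site separate matrices under the
trace pairing. -/
def Separating (B : ℕ → ι → Matrix n n K) (m : ℕ) : Prop :=
  ∀ (k : ℕ) (X : Matrix n n K),
    (∀ w : List ι, w.length = m → (X * siteProd B k w).trace = 0) → X = 0

theorem Separating.span_eq_top {B : ℕ → ι → Matrix n n K} {m : ℕ} (h : Separating B m) (k : ℕ) :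
    Submodule.span K {W | ∃ w : List ι, w.length = m ∧ siteProd B k w = W} = ⊤ := by
  by_contra hne
  obtain ⟨f, hf0, hf⟩ := Submodule.exists_le_ker_of_lt_top _ (lt_top_iff_ne_top.2 hne)
  -- The trace pairing is non-degenerate, so every functional is a trace against some matrix.
  have hX : ∀ W, f W = ((Matrix.of fun i j => f (Matrix.single j i 1)) * W).trace := by
    intro W
    conv_lhs => rw [Matrix.matrix_eq_sum_single W]
    simp only [map_sum, Matrix.trace, Matrix.diag, Matrix.mul_apply, Matrix.of_apply]
    rw [Finset.sum_comm]
    refine Finset.sum_congr rfl fun i _ => Finset.sum_congr rfl fun j _ => ?_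
    have : Matrix.single j i (W j i) = W j i • Matrix.single j i (1 : K) := by simp
    rw [this, map_smul, smul_eq_mul, mul_comm]
  apply hf0
  have h0 := h k (Matrix.of fun i j => f (Matrix.single j i 1)) fun w hw => by
    rw [← hX]
    exact hf (Submodule.subset_span ⟨w, hw, rfl⟩)
  ext1 W
  rw [hX, h0]
  simp

theorem trace_siteProd_rotate {B : ℕ → ι → Matrix n n K} {N : ℕ} (hB : ∀ k, B (k + N) = B k)
    (k : ℕ) (i : ι) (w : List ι) (hw : w.length + 1 = N) :
    (siteProd B (k + 1) (w ++ [i])).trace = (siteProd B k (i :: w)).trace := by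
  rw [siteProd_append, siteProd_cons, siteProd_cons, siteProd_nil, mul_one, Matrix.trace_mul_comm,
    add_assoc, add_comm 1, hw, hB]

theorem trace_siteProd_eq {A B : ℕ → ι → Matrix n n K} {N : ℕ} (hA : ∀ k, A (k + N) = A k)
    (hB : ∀ k, B (k + N) = B k)
    (h : ∀ w : List ι, w.length = N → (siteProd A 0 w).trace = (siteProd B 0 w).trace) (k : ℕ) :
    ∀ w : List ι, w.length = N → (siteProd A k w).trace = (siteProd B k w).trace := by
  induction k with
  | zero => exact h
  | succ k ih =>
    intro w hw
    rcases List.eq_nil_or_concat w with rfl | ⟨u, i, rfl⟩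
    · rfl
    · have hu : u.length + 1 = N := by simpa using hw
      rw [List.concat_eq_append] at *
      rw [trace_siteProd_rotate hA k i u hu, trace_siteProd_rotate hB k i u hu]
      exact ih _ (by simpa using hu)

/-- Two families of tensors generating the same state: corresponding blocks of length `L` are
related by a linear map. -/
theorem exists_blockMap {A B : ℕ → ι → Matrix n n K} {N L : ℕ} (hL : L ≤ N)
    (hsA : Separating A L) (hsB : Separating B (N - L))
    (h : ∀ k, ∀ w : List ι, w.length = N → (siteProd A k w).trace = (siteProd B k w).trace)
    (k : ℕ) :
    ∃ q : Matrix n n K →ₗ[K] Matrix n n K,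
      (∀ w : List ι, w.length = L → q (siteProd A k w) = siteProd B k w) ∧
      ∀ (X : Matrix n n K) (u : List ι), u.length = N - L →
        (q X * siteProd B (k + L) u).trace = (X * siteProd A (k + L) u).trace := by
  let pair (C : ℕ → ι → Matrix n n K) :
      Matrix n n K →ₗ[K] ({u : List ι // u.length = N - L} → K) :=
    LinearMap.pi fun u => (Matrix.traceLinearMap n K K) ∘ₗ
      (LinearMap.mulRight K (siteProd C (k + L) u.1))
  have hpair : ∀ C X u, pair C X u = (X * siteProd C (k + L) u.1).trace := fun _ _ _ => rfl
  -- A matrix is recovered from its pairings with the complementary `B`-words; `q` reads those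
  -- pairings off the `A` side.
  obtain ⟨s, hs⟩ := LinearMap.exists_leftInverse_of_injective (pair B) (by
    rw [LinearMap.ker_eq_bot']
    intro X hX
    exact hsB (k + L) X fun u hu => congrFun hX ⟨u, hu⟩)
  have hw : ∀ w : List ι, w.length = L → pair A (siteProd A k w) = pair B (siteProd B k w) := by
    intro w hw
    ext ⟨u, hu⟩
    have := h k (w ++ u) (by rw [List.length_append]; omega)
    rwa [siteProd_append, siteProd_append, hw] at this
  have hq : ∀ w : List ι, w.length = L → (s ∘ₗ pair A) (siteProd A k w) = siteProd B k w := by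
    intro w hwl
    rw [LinearMap.comp_apply, hw w hwl]
    exact LinearMap.congr_fun hs _
  refine ⟨s ∘ₗ pair A, hq, ?_⟩
  have : pair B ∘ₗ (s ∘ₗ pair A) = pair A := by
    refine LinearMap.ext_on (hsA.span_eq_top k) ?_
    rintro _ ⟨w, hwl, rfl⟩
    rw [LinearMap.comp_apply, hq w hwl, hw w hwl]
  intro X u hu
  exact congrFun (LinearMap.congr_fun this X) ⟨u, hu⟩

/-- A surjective linear map of matrices that intertwines left multiplications is of the form
`W ↦ Z * W * Y`. -/
theorem exists_eq_mul_mul_of_intertwines [Nonempty n] (q : Matrix n n K →ₗ[K] Matrix n n K)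
    (hq : Function.Surjective q) (ρ : Matrix n n K → Matrix n n K)
    (hρ : ∀ X U, q (X * U) = ρ X * q U) :
    ∃ Z Y : Matrix n n K, IsUnit Z ∧ IsUnit Y ∧ ∀ W, q W = Z * W * Y := by
  have hinj : Function.Injective q := LinearMap.injective_iff_surjective.2 hq
  -- With `q U = 1`, `ρ X = q (X * U)` is a multiplicative representation of the matrix algebra; as
  -- in Skolem–Noether it is conjugate to the standard one.
  obtain ⟨U, hU⟩ := hq 1
  have hρU : ∀ X, ρ X = q (X * U) := fun X => by rw [hρ, hU, mul_one]
  have hρmul : ∀ X Y, ρ (X * Y) = ρ X * ρ Y := fun X Y => by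
    rw [hρU, mul_assoc, hρ, ← hρU]
  obtain ⟨a⟩ := ‹Nonempty n›
  have hPne : ρ (Matrix.single a a 1) ≠ 0 := by
    intro h0
    have : Matrix.single a a (1 : K) * 1 = 0 := hinj (by rw [hρ, h0, zero_mul, map_zero])
    rw [mul_one] at this
    have := congrFun (congrFun this a) a
    simp at this
  obtain ⟨u, hu⟩ : ∃ u, ρ (Matrix.single a a 1) *ᵥ u ≠ 0 := by
    by_contra! hcon
    exact hPne (Matrix.mulVec_injective (by ext1 v; simp [hcon v]))
  let φ : (n → K) →ₗ[K] (n → K) :=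
    { toFun := fun w => ρ (Matrix.vecMulVec w (Pi.single a 1)) *ᵥ u
      map_add' := fun x y => by
        simp only [hρU, Matrix.add_vecMulVec, add_mul, map_add, Matrix.add_mulVec]
      map_smul' := fun t x => by
        simp only [hρU, Matrix.smul_vecMulVec, smul_mul_assoc, map_smul, Matrix.smul_mulVec,
          RingHom.id_apply] }
  have hφ : ∀ X w, φ (X *ᵥ w) = ρ X *ᵥ φ w := fun X w => by
    change ρ _ *ᵥ u = ρ X *ᵥ (ρ _ *ᵥ u)
    rw [Matrix.mulVec_mulVec, ← hρmul, Matrix.mul_vecMulVec]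
  let Z := LinearMap.toMatrix' φ
  have hZ : ∀ w, Z *ᵥ w = φ w := fun w => LinearMap.toMatrix'_mulVec φ w
  have hZu : IsUnit Z := by
    rw [← Matrix.mulVec_injective_iff_isUnit]
    intro w w' hww
    by_contra hne
    obtain ⟨i, hi⟩ := Function.ne_iff.1 (sub_ne_zero.2 hne)
    have h0 : φ (w - w') = 0 := by rw [map_sub, ← hZ, ← hZ, sub_eq_zero]; exact hww
    -- A non-zero kernel vector could be moved to `e_a` by a multiple of a matrix unit, but `φ e_a =
    -- ρ (E a a) u ≠ 0`.
    have h1 := hφ (Matrix.single a i ((w - w') i)⁻¹) (w - w')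
    have h2 : Matrix.single a i ((w - w') i)⁻¹ *ᵥ (w - w') = Pi.single a 1 := by
      ext j
      rw [Matrix.single_mulVec]
      simp only [Function.update_apply, Pi.single_apply, Pi.zero_apply]
      split_ifs
      · exact inv_mul_cancel₀ hi
      · rfl
    rw [h0, h2, Matrix.mulVec_zero] at h1
    apply hu
    rw [← h1]
    change _ = ρ _ *ᵥ u
    rw [← Matrix.single_eq_single_vecMulVec_single]
  have hZρ : ∀ X, ρ X * Z = Z * X := fun X => by
    apply Matrix.mulVec_injective
    ext1 w
    rw [← Matrix.mulVec_mulVec, ← Matrix.mulVec_mulVec, hZ, hZ, hφ]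
  obtain ⟨z, hz⟩ := hZu
  refine ⟨Z, (↑z⁻¹ : Matrix n n K) * q 1, ⟨z, hz⟩, ?_, fun W => ?_⟩
  · refine (Units.isUnit _).mul (IsUnit.of_mul_eq_one_right (ρ U) ?_)
    rw [← hρ, mul_one, hU]
  · conv_lhs => rw [← mul_one W, hρ]
    rw [← mul_assoc, ← hZρ, ← hz, mul_assoc (ρ W), Units.mul_inv, mul_one]

end FundamentalTheorem

/-! ### The fundamental theorem: gauges between two families -/

section FundamentalTheorem

variable {ι n K : Type*} [Fintype n] [DecidableEq n] [Field K]

/-- If `x ⊗ v = y ⊗ u` as bilinear maps in the middle matrix, then `y` is a multiple of `x`. -/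
theorem exists_eq_smul_of_mul_mul_eq {x y u v : ι → Matrix n n K} (hu : ∃ j, u j ≠ 0)
    (h : ∀ i j W, x i * W * v j = y i * W * u j) : ∃ l : K, ∀ i, y i = l • x i := by
  obtain ⟨j, hj⟩ := hu
  obtain ⟨c, d, hcd⟩ : ∃ c d, u j c d ≠ 0 := by
    by_contra! h0
    exact hj (by ext c d; exact h0 c d)
  -- Testing with the matrix unit at `(b, c)` gives `x a b * v c d = y a b * u c d`.
  refine ⟨v j c d / u j c d, fun i => ?_⟩
  ext a b
  have := congrFun (congrFun (h i j (Matrix.single b c 1)) a) d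
  rw [mul_assoc, mul_assoc, Matrix.mul_apply, Matrix.mul_apply] at this
  rw [Finset.sum_eq_single b, Finset.sum_eq_single b] at this
  · simp only [Matrix.single_mul_apply_same, one_mul] at this
    rw [Matrix.smul_apply, smul_eq_mul, div_mul_eq_mul_div, eq_div_iff hcd, mul_comm (v j c d)]
    exact this.symm
  · intro e _ he
    rw [Matrix.single_mul_apply_of_ne _ _ _ _ _ he, mul_zero]
  · simp
  · intro e _ he
    rw [Matrix.single_mul_apply_of_ne _ _ _ _ _ he, mul_zero]
  · simp

theorem Separating.exists_ne_zero [Nonempty n] {B : ℕ → ι → Matrix n n K} {m : ℕ}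
    (h : Separating B (m + 1)) (k : ℕ) : ∃ i, B k i ≠ 0 := by
  by_contra! h0
  refine one_ne_zero (h k 1 fun w hw => ?_)
  cases w with
  | nil => simp at hw
  | cons i w => simp [h0]

/-- Fundamental theorem for matrix product states: if two site-dependent families generate the
same state on a ring of `N ≥ 2 * L + 1` sites and all blocks of at least `L` sites are injective,
then the families are related by a gauge transformation. -/
theorem exists_gauge [Nonempty n] {A B : ℕ → ι → Matrix n n K} {N L : ℕ} (hN : 2 * L + 1 ≤ N)
    (hA : ∀ k, A (k + N) = A k) (hB : ∀ k, B (k + N) = B k)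
    (hsA : ∀ m, L ≤ m → Separating A m) (hsB : ∀ m, L ≤ m → Separating B m)
    (h : ∀ w : List ι, w.length = N → (siteProd A 0 w).trace = (siteProd B 0 w).trace) :
    ∃ Z : ℕ → Matrix n n K, (∀ k, IsUnit (Z k)) ∧
      ∀ k, L ≤ k → ∃ l : K, l ≠ 0 ∧ ∀ i, B k i * Z (k + 1) = l • (Z k * A k i) := by
  have htr := trace_siteProd_eq hA hB h
  choose q hq hqt using fun k =>
    exists_blockMap (by omega) (hsA L le_rfl) (hsB (N - L) (by omega)) htr k
  -- Moving the window by one site: both sides have the same traces against the other `N - L - 1`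
  -- sites, and these still separate because `N ≥ 2 * L + 1`.
  have hshift : ∀ k i j W, q k (A k i * W) * B (k + L) j = B k i * q (k + 1) (W * A (k + L) j) := by
    intro k i j W
    rw [← sub_eq_zero]
    refine hsB (N - L - 1) (by omega) (k + L + 1) _ fun u hu => ?_
    rw [sub_mul, Matrix.trace_sub, sub_eq_zero]
    have h1 := hqt k (A k i * W) (j :: u) (by rw [List.length_cons]; omega)
    have h2 := hqt (k + 1) (W * A (k + L) j) (u ++ [i])
      (by rw [List.length_append, List.length_singleton]; omega)
    have hk : k + 1 + L + u.length = k + N := by omega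
    rw [siteProd_append, siteProd_append, hk, siteProd_periodic hA, siteProd_periodic hB] at h2
    simp only [siteProd_cons, siteProd_nil, mul_one] at h1 h2
    rw [add_right_comm k 1 L] at h2
    rw [mul_assoc, h1, mul_assoc (B k i), Matrix.trace_mul_comm (B k i),
      mul_assoc (q (k + 1) _), h2]
    rw [mul_assoc (A k i), Matrix.trace_mul_comm (A k i)]
    simp only [mul_assoc]
  have hchain : ∀ (w u : List ι), w.length = u.length → ∀ k X,
      q k (siteProd A k w * X) * siteProd B (k + L) u =
        siteProd B k w * q (k + w.length) (X * siteProd A (k + L) u) := by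
    intro w
    induction w with
    | nil =>
      intro u hu k X
      obtain rfl : u = [] := List.length_eq_zero_iff.1 hu.symm
      simp
    | cons i w ih =>
      intro u hu k X
      cases u with
      | nil => simp at hu
      | cons j u =>
        rw [siteProd_cons, siteProd_cons, siteProd_cons, siteProd_cons, mul_assoc (A k i),
          ← mul_assoc (q k _), hshift, mul_assoc (B k i), mul_assoc (B k i), mul_assoc (siteProd A _ _),
          add_right_comm k L 1, ih u (by simpa using hu), List.length_cons,
          add_right_comm k 1, add_assoc k, mul_assoc]
  -- After `L` shifts the boundary words are whole blocks, which span all matrices, so words give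
  -- way to arbitrary `W` and `U`.
  have hmul : ∀ k W X U, q k (W * X) * q (k + L) U = q k W * q (k + L) (X * U) := by
    intro k W X U
    have h1 : LinearMap.mulRight K (q (k + L) U) ∘ₗ q k ∘ₗ LinearMap.mulRight K X =
        LinearMap.mulRight K (q (k + L) (X * U)) ∘ₗ q k := by
      refine LinearMap.ext_on ((hsA L le_rfl).span_eq_top k) ?_
      rintro _ ⟨w, hw, rfl⟩
      have h2 : LinearMap.mulLeft K (q k (siteProd A k w * X)) ∘ₗ q (k + L) =
          LinearMap.mulLeft K (q k (siteProd A k w)) ∘ₗ q (k + L) ∘ₗ LinearMap.mulLeft K X := by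
        refine LinearMap.ext_on ((hsA L le_rfl).span_eq_top (k + L)) ?_
        rintro _ ⟨u, hu, rfl⟩
        have := hchain w u (hw.trans hu.symm) k X
        rw [hw] at this
        simpa [hq _ _ hu, hq _ _ hw] using this
      exact LinearMap.congr_fun h2 U
    exact LinearMap.congr_fun h1 W
  have hsurj : ∀ k, Function.Surjective (q k) := by
    intro k
    rw [← LinearMap.range_eq_top, eq_top_iff, ← (hsB L le_rfl).span_eq_top k, Submodule.span_le]
    rintro _ ⟨w, hw, rfl⟩
    exact ⟨_, hq k w hw⟩
  have hform : ∀ k, ∃ Z Y : Matrix n n K, IsUnit Z ∧ IsUnit Y ∧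
      (L ≤ k → ∀ W, q k W = Z * W * Y) := by
    intro k
    by_cases hk : L ≤ k
    -- Choosing `W` with `q k W = 1` in `hmul` makes `q (k + L)` intertwine left multiplications;
    -- hence the restriction to sites from `L` on, with placeholders below.
    · obtain ⟨k, rfl⟩ := Nat.exists_eq_add_of_le' hk
      obtain ⟨W, hW⟩ := hsurj k 1
      obtain ⟨Z, Y, hZ, hY, h⟩ := exists_eq_mul_mul_of_intertwines (q (k + L)) (hsurj _)
        (fun X => q k (W * X)) fun X U => by rw [hmul, hW, one_mul]
      exact ⟨Z, Y, hZ, hY, fun _ => h⟩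
    · exact ⟨1, 1, isUnit_one, isUnit_one, fun h => absurd h hk⟩
  choose Z Y hZ hY hZY using hform
  refine ⟨Z, hZ, fun k hk => ?_⟩
  obtain ⟨z, hz⟩ := hZ k
  obtain ⟨y, hy⟩ := hY (k + 1)
  obtain ⟨l, hl⟩ := exists_eq_smul_of_mul_mul_eq (x := fun i => A k i)
    (y := fun i => (↑z⁻¹ : Matrix n n K) * B k i * Z (k + 1)) (u := fun j => A (k + L) j)
    (v := fun j => Y k * B (k + L) j * (↑y⁻¹ : Matrix n n K)) ((hsA (L + 1) (by omega)).exists_ne_zero _) (by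
      intro i j W
      have := hshift k i j W
      rw [hZY k hk, hZY (k + 1) (by omega), ← hz, ← hy] at this
      calc A k i * W * (Y k * B (k + L) j * (↑y⁻¹ : Matrix n n K))
          = (↑z⁻¹ : Matrix n n K) * (↑z * (A k i * W) * Y k * B (k + L) j) *
              (↑y⁻¹ : Matrix n n K) := by
            simp only [mul_assoc, Units.inv_mul_cancel_left]
        _ = _ := by
            rw [this]
            simp only [mul_assoc, Units.mul_inv, mul_one])
  have hl' : ∀ i, B k i * Z (k + 1) = l • (Z k * A k i) := fun i => by
    rw [← Matrix.mul_smul, ← hl, ← hz]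
    simp only [mul_assoc, Units.mul_inv_cancel_left]
  refine ⟨l, ?_, hl'⟩
  rintro rfl
  obtain ⟨i, hi⟩ := (hsB (L + 1) (by omega)).exists_ne_zero k
  obtain ⟨z', hz'⟩ := hZ (k + 1)
  have := hl' i
  rw [zero_smul, ← hz', Units.mul_left_eq_zero] at this
  exact hi this

end FundamentalTheorem

/-! ### Cyclic chains of congruences in dimension two -/

section CyclicCongruence

/-- These are the entries of `H k * S * (H (k + 1))ᵀ = S'` for `H k = !![1, u k; 0, w k]`, the form
of a map fixing the first basis vector. -/
theorem exists_affine_congruence {p q r s p' q' r' s' : ℂ} {u w : ℕ → ℂ} {N : ℕ}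
    (hN : N ≠ 0) (hu : ∀ k, u (k + N) = u k)
    (hdet : p * s - q * r ≠ 0) (hdet' : p' * s' - q' * r' ≠ 0)
    (h1 : ∀ k, p + u k * r + u (k + 1) * (q + u k * s) = p')
    (h2 : ∀ k, w (k + 1) * (q + u k * s) = q') (h3 : ∀ k, w k * (r + u (k + 1) * s) = r')
    (h4 : ∀ k, w k * w (k + 1) * s = s') :
    ∃ x y : ℂ, p + x * r + x * (q + x * s) = p' ∧ y * (q + x * s) = q' ∧
      y * (r + x * s) = r' ∧ y * y * s = s' := by
  -- Taking determinants: neighbouring `w` have a constant non-zero product, so `w` has period two.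
  have hww : ∀ k, w k * w (k + 1) * (p * s - q * r) = p' * s' - q' * r' := fun k => by
    rw [← h1 k, ← h2 k, ← h3 k, ← h4 k]; ring
  have hw : ∀ k, w k ≠ 0 := fun k h0 => hdet' (by rw [← hww k, h0]; ring)
  have hw2 : ∀ k, w (k + 2) = w k := fun k => by
    have h5 := (hww (k + 1)).trans (hww k).symm
    have h6 : w (k + 1) * (p * s - q * r) ≠ 0 := mul_ne_zero (hw _) hdet
    apply mul_right_cancel₀ h6
    linear_combination h5
  by_cases hs : s = 0
  · subst hs
    have hq : q ≠ 0 := by rintro rfl; simp at hdet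
    have hconst : ∀ k, w (k + 1) = q' / q := fun k => by
      rw [eq_div_iff hq]; simpa using h2 k
    have hyr : q' / q * r = r' := by rw [← hconst 0]; simpa using h3 1
    have hyq : q' / q * q = q' := div_mul_cancel₀ _ hq
    have hs' : s' = 0 := by simpa using (h4 0).symm
    -- If `q + r = 0`, `u` is an arithmetic progression and periodicity forces its step to vanish;
    -- this is the only use of the ring closing up. Otherwise `x` solves a linear equation.
    by_cases hqr : q + r = 0
    · have hstep : ∀ k, u k = u 0 + k * ((p' - p) / q) := by
        intro k
        induction k with
        | zero => simp
        | succ k ih =>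
          have : u (k + 1) = u k + (p' - p) / q := by
            field_simp
            linear_combination h1 k - u k * hqr
          rw [this, ih]; push_cast; ring
      have hpp : (p' - p) / q = 0 := by
        have h5 := hstep N
        have h6 := hu 0
        rw [zero_add] at h6
        rw [h6, left_eq_add] at h5
        exact (mul_eq_zero.1 h5).resolve_left (Nat.cast_ne_zero.2 hN)
      have hpp' : p' = p := by
        rw [div_eq_zero_iff] at hpp
        exact sub_eq_zero.1 (hpp.resolve_right hq)
      exact ⟨0, q' / q, by simp [hpp'], by simpa using hyq, by simpa using hyr, by simp [hs']⟩
    · refine ⟨(p' - p) / (q + r), q' / q, ?_, by simpa using hyq, by simpa using hyr,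
        by simp [hs']⟩
      field_simp
      ring
  · have hw20 : w 2 = w 0 := hw2 0
    have hw31 : w 3 = w 1 := hw2 1
    have e0 : w 0 * (q - r) = q' - r' := by
      have h5 := h2 1
      have h6 := h3 0
      norm_num at h5 h6
      rw [hw20] at h5
      linear_combination h5 - h6
    have e1 : w 1 * (q - r) = q' - r' := by
      have h5 := h2 2
      have h6 := h3 1
      norm_num at h5 h6
      rw [hw31] at h5
      linear_combination h5 - h6
    have g1 := h1 0
    have g2 := h2 0
    have g3 := h3 0
    have g4 := h4 0
    rw [zero_add] at g1 g2 g3 g4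
    by_cases hqr : q = r
    · subst hqr
      have hq' : q' = r' := by
        rw [sub_self, mul_zero] at e0
        exact (sub_eq_zero.1 e0.symm)
      subst hq'
      -- In the symmetric case `w` may alternate, and its geometric mean replaces both values. The
      -- off-diagonal entry fixes `x`; the corner entry then follows from the determinant.
      obtain ⟨y, hy⟩ := IsAlgClosed.exists_pow_nat_eq (w 0 * w 1) two_pos
      have hy0 : y ≠ 0 := by
        rintro rfl
        exact mul_ne_zero (hw 0) (hw 1) (by rw [← hy]; norm_num)
      have hx : q + (q' / y - q) / s * s = q' / y := by field_simp; ring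
      refine ⟨(q' / y - q) / s, y, ?_, ?_, ?_, ?_⟩
      · rw [hx]
        apply mul_left_cancel₀ (mul_ne_zero hs (pow_ne_zero 2 hy0))
        have : s * y ^ 2 * (p + (q' / y - q) / s * q + (q' / y - q) / s * (q' / y)) =
            y ^ 2 * (p * s - q * q) + q' * q' := by
          field_simp
          ring
        rw [this, hy]
        linear_combination s * w 0 * w 1 * g1 - w 0 * (q + u 1 * s) * g2 - q' * g3
      · rw [hx]; field_simp
      · rw [hx]; field_simp
      · rw [← sq, hy, g4]
    · have hw01 : w 1 = w 0 := mul_right_cancel₀ (sub_ne_zero.2 hqr) (e1.trans e0.symm)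
      have hu01 : u 1 = u 0 := by
        have h5 := h2 1
        norm_num at h5
        rw [hw20] at h5
        rw [hw01] at g2
        apply mul_left_cancel₀ (mul_ne_zero (hw 0) hs)
        linear_combination h5 - g2
      rw [hw01] at g2 g4
      rw [hu01] at g1 g3
      exact ⟨u 0, w 0, g1, g2, g3, g4⟩

theorem det_ne_zero_of_isUnit {m : Type*} [Fintype m] [DecidableEq m] {M : Matrix m m ℂ}
    (h : IsUnit M) : M.det ≠ 0 := ((Matrix.isUnit_iff_isUnit_det M).1 h).ne_zero

/-- A basis of `ℂ²` that starts with a prescribed non-zero vector. -/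
theorem exists_det_ne_zero_mulVec_eq {v : Fin 2 → ℂ} (hv : v ≠ 0) :
    ∃ P : Matrix (Fin 2) (Fin 2) ℂ, P.det ≠ 0 ∧ P *ᵥ ![1, 0] = v := by
  by_cases h : v 0 = 0
  · have h1 : v 1 ≠ 0 := fun h1 => hv (by ext i; fin_cases i <;> simp [h, h1])
    exact ⟨!![v 0, 1; v 1, 0], by simp [Matrix.det_fin_two, h1],
      by ext i; fin_cases i <;> simp [Matrix.mulVec, dotProduct, Fin.sum_univ_two]⟩
  · exact ⟨!![v 0, 0; v 1, 1], by simp [Matrix.det_fin_two, h],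
      by ext i; fin_cases i <;> simp [Matrix.mulVec, dotProduct, Fin.sum_univ_two]⟩

/-- A cyclic chain of congruences between two bilinear forms which all carry one vector to another
can be replaced by a single congruence. -/
theorem exists_congruence_of_cyclic {v v' : Fin 2 → ℂ} {U U' : Matrix (Fin 2) (Fin 2) ℂ}
    {f : ℕ → Matrix (Fin 2) (Fin 2) ℂ} {N : ℕ} (hN : N ≠ 0) (hf : ∀ k, f (k + N) = f k)
    (hv : v ≠ 0) (hv' : v' ≠ 0) (hU : U.det ≠ 0) (hU' : U'.det ≠ 0)
    (hfv : ∀ k, f k *ᵥ v = v') (hfU : ∀ k, f k * U * (f (k + 1))ᵀ = U') :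
    ∃ F : Matrix (Fin 2) (Fin 2) ℂ, F *ᵥ v = v' ∧ F * U * Fᵀ = U' := by
  obtain ⟨P, hP, hPv⟩ := exists_det_ne_zero_mulVec_eq hv
  obtain ⟨R, hR, hRv⟩ := exists_det_ne_zero_mulVec_eq hv'
  have hP1 : P * P⁻¹ = 1 := Matrix.mul_nonsing_inv P (isUnit_iff_ne_zero.2 hP)
  have hP2 : P⁻¹ * P = 1 := Matrix.nonsing_inv_mul P (isUnit_iff_ne_zero.2 hP)
  have hR1 : R * R⁻¹ = 1 := Matrix.mul_nonsing_inv R (isUnit_iff_ne_zero.2 hR)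
  have hR2 : R⁻¹ * R = 1 := Matrix.nonsing_inv_mul R (isUnit_iff_ne_zero.2 hR)
  set S := P⁻¹ * U * P⁻¹ᵀ with hS
  set S' := R⁻¹ * U' * R⁻¹ᵀ with hS'
  set H : ℕ → Matrix (Fin 2) (Fin 2) ℂ := fun k => R⁻¹ * f k * P with hH
  have hPT : (P * P⁻¹)ᵀ = 1 := by rw [hP1, Matrix.transpose_one]
  have hRT : (R * R⁻¹)ᵀ = 1 := by rw [hR1, Matrix.transpose_one]
  rw [Matrix.transpose_mul] at hPT hRT
  have hHv : ∀ k, H k *ᵥ ![1, 0] = ![1, 0] := fun k => by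
    rw [hH]
    simp only
    rw [← Matrix.mulVec_mulVec, ← Matrix.mulVec_mulVec, hPv, hfv, ← hRv, Matrix.mulVec_mulVec,
      hR2, Matrix.one_mulVec]
  have hHS : ∀ k, H k * S * (H (k + 1))ᵀ = S' := fun k => by
    have : H k * S * (H (k + 1))ᵀ =
        R⁻¹ * (f k * (P * P⁻¹) * U * (P⁻¹ᵀ * Pᵀ) * (f (k + 1))ᵀ) * R⁻¹ᵀ := by
      simp only [hH, hS, Matrix.transpose_mul, mul_assoc]
    rw [this, hP1, hPT, mul_one, mul_one, hfU]
  have hSdet : S.det ≠ 0 := by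
    rw [hS, Matrix.det_mul, Matrix.det_mul, Matrix.det_transpose, Matrix.det_nonsing_inv,
      Ring.inverse_eq_inv']
    exact mul_ne_zero (mul_ne_zero (inv_ne_zero hP) hU) (inv_ne_zero hP)
  have hSdet' : S'.det ≠ 0 := by
    rw [hS', Matrix.det_mul, Matrix.det_mul, Matrix.det_transpose, Matrix.det_nonsing_inv,
      Ring.inverse_eq_inv']
    exact mul_ne_zero (mul_ne_zero (inv_ne_zero hR) hU') (inv_ne_zero hR)
  have c0 : ∀ k, H k 0 0 = 1 := fun k => by
    simpa [Matrix.mulVec, dotProduct, Fin.sum_univ_two] using congrFun (hHv k) 0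
  have c1 : ∀ k, H k 1 0 = 0 := fun k => by
    simpa [Matrix.mulVec, dotProduct, Fin.sum_univ_two] using congrFun (hHv k) 1
  have hent : ∀ k i j, (H k * S * (H (k + 1))ᵀ) i j = S' i j := fun k i j => by rw [hHS]
  simp only [Matrix.mul_apply, Fin.sum_univ_two, Matrix.transpose_apply] at hent
  rw [Matrix.det_fin_two] at hSdet hSdet'
  obtain ⟨x, y, h1, h2, h3, h4⟩ := exists_affine_congruence (u := fun k => H k 0 1)
    (w := fun k => H k 1 1) hN (fun k => by simp only [hH, hf]) hSdet hSdet'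
    (fun k => by have := hent k 0 0; simp only [c0] at this; linear_combination this)
    (fun k => by have := hent k 0 1; simp only [c0, c1] at this; linear_combination this)
    (fun k => by have := hent k 1 0; simp only [c0, c1] at this; linear_combination this)
    (fun k => by have := hent k 1 1; simp only [c1] at this; linear_combination this)
  have hX1 : !![1, x; 0, y] *ᵥ ![1, 0] = ![1, 0] := by
    ext i; fin_cases i <;> simp [Matrix.mulVec, dotProduct, Fin.sum_univ_two]
  have hX2 : !![1, x; 0, y] * S * !![1, x; 0, y]ᵀ = S' := by
    ext i j
    fin_cases i <;> fin_cases j <;>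
      simp [Matrix.mul_apply, Fin.sum_univ_two, Matrix.vecMul, dotProduct]
    · linear_combination h1
    · linear_combination h2
    · linear_combination h3
    · linear_combination h4
  refine ⟨R * !![1, x; 0, y] * P⁻¹, ?_, ?_⟩
  · rw [← hPv, ← Matrix.mulVec_mulVec, ← Matrix.mulVec_mulVec, Matrix.mulVec_mulVec _ P⁻¹, hP2,
      Matrix.one_mulVec, hX1, hRv]
  · have : R * !![1, x; 0, y] * P⁻¹ * U * (R * !![1, x; 0, y] * P⁻¹)ᵀ =
        R * (!![1, x; 0, y] * S * !![1, x; 0, y]ᵀ) * Rᵀ := by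
      simp only [hS, Matrix.transpose_mul, mul_assoc]
    rw [this, hX2, hS']
    have : R * (R⁻¹ * U' * R⁻¹ᵀ) * Rᵀ = (R * R⁻¹) * U' * (R⁻¹ᵀ * Rᵀ) := by
      simp only [mul_assoc]
    rw [this, hR1, hRT, one_mul, mul_one]

end CyclicCongruence

/-! ### Symmetries of the LLT pencil and elimination of the gauge -/

section Pencil

/-- The operation on the first bond index that accompanies `g` in a symmetry of `|LLT⟩`. -/
def leftSym (g : Matrix (Fin 2) (Fin 2) ℂ) : Matrix (Fin 3) (Fin 3) ℂ :=
  !![1, 0, 0; 0, g 1 1, g 0 1; 0, g 1 0, g 0 0]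

/-- The operation on the second bond index that accompanies `g` in a symmetry of `|LLT⟩`. -/
def rightSym (g : Matrix (Fin 2) (Fin 2) ℂ) : Matrix (Fin 3) (Fin 3) ℂ :=
  !![g 1 1, g 1 0, 0; g 0 1, g 0 0, 0; 0, 0, 1]

theorem det_leftSym (g : Matrix (Fin 2) (Fin 2) ℂ) : (leftSym g).det = g.det := by
  simp [leftSym, Matrix.det_fin_three, Matrix.det_fin_two]; ring

/-- Each Kronecker block identifies the physical qubit with a two-dimensional bond space, so `g` can
be moved onto that bond. -/
theorem sum_smul_tensorLLT (g : Matrix (Fin 2) (Fin 2) ℂ) (i : Fin 2) :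
    ∑ j, g i j • tensorLLT j = leftSym g * tensorLLT i * rightSym g := by
  ext α β
  fin_cases i <;> fin_cases α <;> fin_cases β <;>
    simp [tensorLLT, leftSym, rightSym, Matrix.mul_apply, Fin.sum_univ_succ]

theorem sum_smul_fiducial (c : Matrix (Fin 3) (Fin 3) ℂ) (g : Matrix (Fin 2) (Fin 2) ℂ)
    (i : Fin 2) :
    ∑ j, g i j • fiducial c j = c * leftSym g * tensorLLT i * rightSym g := by
  simp only [fiducial, ← Matrix.mul_smul, ← Matrix.mul_sum, sum_smul_tensorLLT, mul_assoc]

/-- Endomorphisms of the pencil: a scalar on each block, `a` and `d`, and the maps `p, q` from one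
block to the other. -/
theorem tensorLLT_intertwiner {Y H : Matrix (Fin 3) (Fin 3) ℂ}
    (h : ∀ i, tensorLLT i * Y = H * tensorLLT i) :
    ∃ a d p q : ℂ, H = !![a, p, q; 0, d, 0; 0, 0, d] ∧ Y = !![a, 0, p; 0, a, q; 0, 0, d] := by
  have e : ∀ i α β, (tensorLLT i * Y) α β = (H * tensorLLT i) α β := fun i α β => by rw [h]
  simp only [Matrix.mul_apply, Fin.sum_univ_three] at e
  have e0 := e 0
  have e1 := e 1
  simp only [Fin.forall_fin_succ, tensorLLT] at e0 e1
  simp at e0 e1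
  refine ⟨H 0 0, H 1 1, H 0 1, H 0 2, ?_, ?_⟩ <;>
    · ext α β
      fin_cases α <;> fin_cases β <;> simp <;> grind

theorem exists_gauge_entries {b c Z Z' : Matrix (Fin 3) (Fin 3) ℂ} {g : Matrix (Fin 2) (Fin 2) ℂ}
    {l : ℂ} (hc : c.det ≠ 0) (hg : g.det ≠ 0)
    (h : ∀ i, (∑ j, g i j • fiducial c j) * Z' = l • (Z * fiducial b i)) :
    ∃ a d p q : ℂ, l • (Z * b) = c * leftSym g * !![a, p, q; 0, d, 0; 0, 0, d] ∧
      rightSym g * Z' = !![a, 0, p; 0, a, q; 0, 0, d] := by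
  have hD : IsUnit (c * leftSym g).det := by
    rw [Matrix.det_mul, det_leftSym]
    exact (mul_ne_zero hc hg).isUnit
  have hDH : (c * leftSym g) * ((c * leftSym g)⁻¹ * (l • (Z * b))) = l • (Z * b) := by
    rw [← mul_assoc, Matrix.mul_nonsing_inv _ hD, one_mul]
  obtain ⟨a, d, p, q, h1, h2⟩ := tensorLLT_intertwiner (Y := rightSym g * Z')
    (H := (c * leftSym g)⁻¹ * (l • (Z * b))) fun i => by
      have hi := h i
      rw [sum_smul_fiducial, fiducial, ← mul_assoc Z, ← Matrix.smul_mul, ← hDH,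
        mul_assoc (c * leftSym g), mul_assoc (c * leftSym g), mul_assoc (c * leftSym g)] at hi
      have := ((Matrix.isUnit_iff_isUnit_det _).2 hD).mul_left_cancel hi
      rwa [mul_assoc] at this
  exact ⟨a, d, p, q, by rw [← h1, hDH], h2⟩

/-- The matrix `T_b` as a bilinear form on the space that contains `v_b`. -/
def bilinT (b : Matrix (Fin 3) (Fin 3) ℂ) : Matrix (Fin 2) (Fin 2) ℂ :=
  !![b 1 2 - b 1 0 * b 2 2, b 1 1 - b 1 0 * b 2 1; b 0 2 - b 0 0 * b 2 2, b 0 1 - b 0 0 * b 2 1]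

theorem det_bilinT {b : Matrix (Fin 3) (Fin 3) ℂ} (hb : b 2 0 = 1) : (bilinT b).det = b.det := by
  simp [bilinT, Matrix.det_fin_three, Matrix.det_fin_two, hb]; ring

/-- The gauge `Z` on a bond is described by the site on its left through `h` and by the site on its
right through `h'`. Eliminating `Z`, and the first column to remove `p', q'`, leaves the form. -/
theorem gauge_bilinT {b c Z : Matrix (Fin 3) (Fin 3) ℂ} {g g' : Matrix (Fin 2) (Fin 2) ℂ}
    {l' a d p q a' d' p' q' : ℂ} (hb : b 2 0 = 1) (hc : c 2 0 = 1)
    (h : rightSym g * Z = !![a, 0, p; 0, a, q; 0, 0, d])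
    (h' : l' • (Z * b) = c * leftSym g' * !![a', p', q'; 0, d', 0; 0, 0, d']) :
    a' = l' * d ∧ (l' * a) • bilinT b = d' • (g * bilinT c * g'ᵀ) := by
  have e : ∀ α β, (rightSym g * Z) α β = !![a, 0, p; 0, a, q; 0, 0, d] α β := fun α β => by rw [h]
  have e' : ∀ α β, (l' • (Z * b)) α β =
      (c * leftSym g' * !![a', p', q'; 0, d', 0; 0, 0, d']) α β := fun α β => by rw [h']
  simp only [Fin.forall_fin_succ, rightSym, leftSym, Matrix.smul_apply, Matrix.mul_apply,
    Fin.sum_univ_three] at e e'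
  simp [hb, hc] at e e'
  obtain ⟨⟨z00, z01, z02⟩, ⟨z10, z11, z12⟩, z20, z21, z22⟩ := e
  obtain ⟨⟨f00, f01, f02⟩, ⟨f10, f11, f12⟩, f20, f21, f22⟩ := e'
  rw [z20, z21, z22] at f20 f21 f22
  refine ⟨by linear_combination -f20, ?_⟩
  ext i j
  fin_cases i <;> fin_cases j <;>
    simp [bilinT, Matrix.mul_apply, Fin.sum_univ_two]
  · linear_combination g 0 1 * (f02 - b 2 2 * f00 - c 0 0 * (f22 - b 2 2 * f20)) +
      g 0 0 * (f12 - b 2 2 * f10 - c 1 0 * (f22 - b 2 2 * f20)) -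
      l' * (b 0 2 - b 0 0 * b 2 2) * z10 - l' * (b 1 2 - b 1 0 * b 2 2) * z11
  · linear_combination g 0 1 * (f01 - b 2 1 * f00 - c 0 0 * (f21 - b 2 1 * f20)) +
      g 0 0 * (f11 - b 2 1 * f10 - c 1 0 * (f21 - b 2 1 * f20)) -
      l' * (b 0 1 - b 0 0 * b 2 1) * z10 - l' * (b 1 1 - b 1 0 * b 2 1) * z11
  · linear_combination g 1 1 * (f02 - b 2 2 * f00 - c 0 0 * (f22 - b 2 2 * f20)) +
      g 1 0 * (f12 - b 2 2 * f10 - c 1 0 * (f22 - b 2 2 * f20)) -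
      l' * (b 0 2 - b 0 0 * b 2 2) * z00 - l' * (b 1 2 - b 1 0 * b 2 2) * z01
  · linear_combination g 1 1 * (f01 - b 2 1 * f00 - c 0 0 * (f21 - b 2 1 * f20)) +
      g 1 0 * (f11 - b 2 1 * f10 - c 1 0 * (f21 - b 2 1 * f20)) -
      l' * (b 0 1 - b 0 0 * b 2 1) * z00 - l' * (b 1 1 - b 1 0 * b 2 1) * z01

theorem det_rightSym (g : Matrix (Fin 2) (Fin 2) ℂ) : (rightSym g).det = g.det := by
  simp [rightSym, Matrix.det_fin_three, Matrix.det_fin_two]; ring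

/-- The parameters `p, q` of a site enter both of its bonds. Eliminating them from the two bond
equations produces the sums of entries that make up `vecV`; this needs three consecutive sites. -/
theorem gauge_vecV {b c Z Z' : Matrix (Fin 3) (Fin 3) ℂ} {g₀ g g' : Matrix (Fin 2) (Fin 2) ℂ}
    {l l' a₀ d₀ p₀ q₀ a d p q a' d' p' q' : ℂ} (hb : b 2 0 = 1) (hc : c 2 0 = 1) (hl' : l' ≠ 0)
    (h₀ : rightSym g₀ * Z = !![a₀, 0, p₀; 0, a₀, q₀; 0, 0, d₀])
    (h₁ : l • (Z * b) = c * leftSym g * !![a, p, q; 0, d, 0; 0, 0, d])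
    (h : rightSym g * Z' = !![a, 0, p; 0, a, q; 0, 0, d])
    (h' : l' • (Z' * b) = c * leftSym g' * !![a', p', q'; 0, d', 0; 0, 0, d']) :
    a • vecV b = d • (g *ᵥ vecV c) := by
  have ha : a = l * d₀ := (gauge_bilinT hb hc h₀ h₁).1
  have ha' : a' = l' * d := (gauge_bilinT hb hc h h').1
  have e₀ : ∀ α β, (rightSym g₀ * Z) α β = !![a₀, 0, p₀; 0, a₀, q₀; 0, 0, d₀] α β :=
    fun α β => by rw [h₀]
  have e₁ : ∀ α β, (l • (Z * b)) α β =
      (c * leftSym g * !![a, p, q; 0, d, 0; 0, 0, d]) α β := fun α β => by rw [h₁]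
  have e : ∀ α β, (rightSym g * Z') α β = !![a, 0, p; 0, a, q; 0, 0, d] α β :=
    fun α β => by rw [h]
  have e' : ∀ α β, (l' • (Z' * b)) α β =
      (c * leftSym g' * !![a', p', q'; 0, d', 0; 0, 0, d']) α β := fun α β => by rw [h']
  simp only [Fin.forall_fin_succ, rightSym, leftSym, Matrix.smul_apply, Matrix.mul_apply,
    Fin.sum_univ_three] at e₀ e₁ e e'
  simp [hb, hc] at e₀ e₁ e e'
  obtain ⟨-, -, y20, y21, y22⟩ := e₀
  obtain ⟨-, -, -, k21, k22⟩ := e₁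
  obtain ⟨⟨z00, z01, z02⟩, z10, z11, z12⟩ := e.imp_right fun h => h.1
  obtain ⟨⟨f00, -, -⟩, ⟨f10, -, -⟩, -⟩ := e'
  rw [y20, y21, y22] at k21 k22
  ext i
  apply mul_left_cancel₀ hl'
  fin_cases i <;> simp [vecV, -mul_eq_mul_left_iff]
  · linear_combination g 0 1 * f00 + g 0 0 * f10 - l' * (b 0 0 * z10 + b 1 0 * z11 + z12) +
      l' * k22 + l' * b 2 2 * ha + (g 0 1 * c 0 0 + g 0 0 * c 1 0) * ha'
  · linear_combination g 1 1 * f00 + g 1 0 * f10 - l' * (b 0 0 * z00 + b 1 0 * z01 + z02) +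
      l' * k21 + l' * b 2 1 * ha + (g 1 1 * c 0 0 + g 1 0 * c 1 0) * ha'

/-- With `J = !![0, -1; 1, 0]` one has `matT b = (bilinT b)ᵀ * J`, and `g⁻¹ = J⁻¹ * gᵀ * J` when
`det g = 1`, so conjugation becomes congruence. -/
theorem paramRelated_iff {b c : Matrix (Fin 3) (Fin 3) ℂ} {g : Matrix (Fin 2) (Fin 2) ℂ}
    (hg : g.det = 1) :
    ParamRelated b c g ↔ ∃ t : ℂ, t ≠ 0 ∧ vecV b = t • (g *ᵥ vecV c) ∧
      bilinT b = t ^ 2 • (g * bilinT c * gᵀ) := by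
  have hinv : g⁻¹ = !![g 1 1, -g 0 1; -g 1 0, g 0 0] := by
    rw [Matrix.inv_def, hg, Ring.inverse_one, one_smul, Matrix.adjugate_fin_two]
  refine exists_congr fun t => and_congr_right fun _ => and_congr_right fun _ => ?_
  rw [hinv, ← Matrix.ext_iff, ← Matrix.ext_iff]
  simp only [Fin.forall_fin_two]
  simp [matT, bilinT, Matrix.mul_apply, Fin.sum_univ_two]
  constructor
  · rintro ⟨⟨h1, h2⟩, h3, h4⟩
    exact ⟨⟨by linear_combination -h2, by linear_combination -h4⟩,
      by linear_combination h1, by linear_combination h3⟩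
  · rintro ⟨⟨h1, h2⟩, h3, h4⟩
    exact ⟨⟨by linear_combination h3, by linear_combination -h1⟩,
      by linear_combination h4, by linear_combination -h2⟩

theorem paramRelated_of_gauge {b c : Matrix (Fin 3) (Fin 3) ℂ} {N : ℕ} (hN : N ≠ 0)
    (hb : b.det ≠ 0) (hc : c.det ≠ 0) (hb20 : b 2 0 = 1) (hc20 : c 2 0 = 1)
    (hvb : vecV b ≠ 0) (hvc : vecV c ≠ 0)
    {g : ℕ → Matrix (Fin 2) (Fin 2) ℂ} (hg : ∀ k, (g k).det ≠ 0) (hgN : ∀ k, g (k + N) = g k)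
    {Z : ℕ → Matrix (Fin 3) (Fin 3) ℂ} (hZ : ∀ k, IsUnit (Z k))
    {l : ℕ → ℂ} (hl : ∀ k, l k ≠ 0)
    (h : ∀ k i, (∑ j, g k i j • fiducial c j) * Z (k + 1) = l k • (Z k * fiducial b i)) :
    ∃ F : Matrix.SpecialLinearGroup (Fin 2) ℂ,
      ParamRelated b c (F : Matrix (Fin 2) (Fin 2) ℂ) := by
  choose a d p q hl₁ hr using fun k => exists_gauge_entries hc (hg k) (h k)
  have had : ∀ k, a k ≠ 0 ∧ d k ≠ 0 := fun k => by
    have h1 : (rightSym (g k) * Z (k + 1)).det ≠ 0 := by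
      rw [Matrix.det_mul, det_rightSym]
      exact mul_ne_zero (hg k) (det_ne_zero_of_isUnit (hZ _))
    rw [hr] at h1
    constructor <;> intro h0 <;> simp [Matrix.det_fin_three, h0] at h1
  have hV : ∀ k, ((d (k + 1) / a (k + 1)) • g (k + 1)) *ᵥ vecV c = vecV b := fun k => by
    have := gauge_vecV hb20 hc20 (hl (k + 2)) (hr k) (hl₁ (k + 1)) (hr (k + 1)) (hl₁ (k + 2))
    rw [Matrix.smul_mulVec, div_eq_inv_mul, mul_smul, ← this, smul_smul,
      inv_mul_cancel₀ (had _).1, one_smul]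
  have hU : ∀ k, ((d k / a k) • g k) * bilinT c * ((d (k + 1) / a (k + 1)) • g (k + 1))ᵀ =
      bilinT b := fun k => by
    obtain ⟨h1, h2⟩ := gauge_bilinT hb20 hc20 (hr k) (hl₁ (k + 1))
    rw [Matrix.transpose_smul, Matrix.mul_smul, Matrix.smul_mul, Matrix.smul_mul, smul_smul]
    have h3 : d (k + 1) / a (k + 1) * (d k / a k) = (l (k + 1) * a k)⁻¹ * d (k + 1) := by
      have := (had k).1
      have := (had k).2
      have := hl (k + 1)
      rw [h1]
      field_simp
    rw [h3, mul_smul, ← h2, smul_smul, inv_mul_cancel₀ (mul_ne_zero (hl _) (had k).1), one_smul]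
  -- Nothing makes `Z`, and with it `a` and `d`, periodic; the scalar in front of `g` is fixed by
  -- sending `vecV c` to the non-zero `vecV b`.
  have hper : ∀ k, (d (k + N + 1) / a (k + N + 1)) • g (k + N + 1) =
      (d (k + 1) / a (k + 1)) • g (k + 1) := fun k => by
    have h1 := (hV (k + N)).trans (hV k).symm
    rw [add_right_comm, hgN] at h1 ⊢
    rw [Matrix.smul_mulVec, Matrix.smul_mulVec, ← sub_eq_zero, ← sub_smul, smul_eq_zero,
      sub_eq_zero] at h1
    rcases h1 with h1 | h1
    · rw [h1]
    · have := hV k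
      rw [Matrix.smul_mulVec, h1, smul_zero] at this
      exact absurd this.symm hvb
  rw [← det_bilinT hb20] at hb
  rw [← det_bilinT hc20] at hc
  obtain ⟨F, hF1, hF2⟩ := exists_congruence_of_cyclic
    (f := fun k => (d (k + 1) / a (k + 1)) • g (k + 1)) hN hper hvc hvb hc hb hV
    (fun k => hU (k + 1))
  have hFdet : F.det ≠ 0 := fun h0 => hb (by
    rw [← hF2, Matrix.det_mul, Matrix.det_mul, h0, zero_mul, zero_mul])
  obtain ⟨t, ht⟩ := IsAlgClosed.exists_pow_nat_eq F.det two_pos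
  have ht0 : t ≠ 0 := by
    rintro rfl
    exact hFdet (by rw [← ht]; norm_num)
  have hdet : (t⁻¹ • F).det = 1 := by
    rw [Matrix.det_smul, Fintype.card_fin, ← ht, inv_pow, inv_mul_cancel₀ (pow_ne_zero 2 ht0)]
  refine ⟨⟨t⁻¹ • F, hdet⟩, (paramRelated_iff hdet).2 ⟨t, ht0, ?_, ?_⟩⟩
  · rw [Matrix.smul_mulVec, smul_smul, mul_inv_cancel₀ ht0, one_smul, hF1]
  · rw [Matrix.transpose_smul, Matrix.mul_smul, Matrix.smul_mul, Matrix.smul_mul, smul_smul,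
      smul_smul, hF2]
    have : t ^ 2 * t⁻¹ * t⁻¹ = 1 := by field_simp
    rw [this, one_smul]

theorem exists_gauge_of_paramRelated {b c : Matrix (Fin 3) (Fin 3) ℂ}
    (hb20 : b 2 0 = 1) (hc20 : c 2 0 = 1) {g : Matrix (Fin 2) (Fin 2) ℂ} (hg : g.det = 1)
    (h : ParamRelated b c g) :
    ∃ (Z : Matrix (Fin 3) (Fin 3) ℂ) (l : ℂ), IsUnit Z ∧ l ≠ 0 ∧
      ∀ i, (∑ j, g i j • fiducial c j) * Z = l • (Z * fiducial b i) := by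
  obtain ⟨t, ht, hv, hU⟩ := (paramRelated_iff hg).1 h
  have hQ : IsUnit (rightSym g).det := by rw [det_rightSym, hg]; exact isUnit_one
  have hQ' := (Matrix.isUnit_iff_isUnit_det _).2 hQ
  -- Normalising `a = 1`, `d = t` forces `l = t⁻¹`; the bottom row of `key` then determines `p` and
  -- `q`.
  obtain ⟨p, hp⟩ : ∃ p, p = b 2 1 - t * (c 2 1 * g 1 1 + c 2 2 * g 1 0) := ⟨_, rfl⟩
  obtain ⟨q, hq⟩ : ∃ q, q = b 2 2 - t * (c 2 1 * g 0 1 + c 2 2 * g 0 0) := ⟨_, rfl⟩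
  set Y : Matrix (Fin 3) (Fin 3) ℂ := !![1, 0, p; 0, 1, q; 0, 0, t] with hY
  set H : Matrix (Fin 3) (Fin 3) ℂ := !![1, p, q; 0, t, 0; 0, 0, t] with hH
  have hYu : IsUnit Y := by
    rw [Matrix.isUnit_iff_isUnit_det, hY]
    simpa [Matrix.det_fin_three] using ht
  have hQZ : rightSym g * ((rightSym g)⁻¹ * Y) = Y := Matrix.mul_nonsing_inv_cancel_left _ _ hQ
  have key : rightSym g * (t • (c * leftSym g * H)) = Y * b := by
    have hv0 := congrFun hv 0
    have hv1 := congrFun hv 1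
    have hU' : ∀ i j, bilinT b i j = (t ^ 2 • (g * bilinT c * gᵀ)) i j := fun i j => by rw [← hU]
    simp only [Fin.forall_fin_two] at hU'
    simp [vecV] at hv0 hv1
    simp [bilinT, Matrix.mul_apply, Fin.sum_univ_two] at hU'
    obtain ⟨⟨u00, u01⟩, u10, u11⟩ := hU'
    ext i j
    simp only [rightSym, leftSym, hY, hH, Matrix.smul_apply, Matrix.mul_apply, Fin.sum_univ_three]
    fin_cases i <;> fin_cases j <;> simp [hb20, hc20, -mul_eq_mul_left_iff]
    · linear_combination -hv1 - hp
    · linear_combination -u11 - (p + t * (c 2 1 * g 1 1 + c 2 2 * g 1 0)) * hv1 +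
        (b 0 0 - t * (c 2 1 * g 1 1 + c 2 2 * g 1 0)) * hp
    · linear_combination -u10 - (q + t * (c 2 1 * g 0 1 + c 2 2 * g 0 0)) * hv1 +
        (b 0 0 + b 2 1 - t * (c 2 1 * g 1 1 + c 2 2 * g 1 0)) * hq - b 2 2 * hp
    · linear_combination -hv0 - hq
    · linear_combination -u01 - (p + t * (c 2 1 * g 1 1 + c 2 2 * g 1 0)) * hv0 +
        (b 1 0 + b 2 2 - t * (c 2 1 * g 0 1 + c 2 2 * g 0 0)) * hp - b 2 1 * hq
    · linear_combination -u00 - (q + t * (c 2 1 * g 0 1 + c 2 2 * g 0 0)) * hv0 +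
        (b 1 0 - t * (c 2 1 * g 0 1 + c 2 2 * g 0 0)) * hq
    · linear_combination t * hp
    · linear_combination t * hq

  have hZb : t • (c * leftSym g * H) = (rightSym g)⁻¹ * Y * b := by
    apply hQ'.mul_left_cancel
    rw [key, mul_assoc, Matrix.mul_nonsing_inv_cancel_left _ _ hQ]
  refine ⟨(rightSym g)⁻¹ * Y, t⁻¹, ?_, inv_ne_zero ht, fun i => ?_⟩
  · exact (Matrix.isUnit_nonsing_inv_iff.2 hQ').mul hYu
  · have hYH : tensorLLT i * Y = H * tensorLLT i := by
      ext α β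
      fin_cases i <;> fin_cases α <;> fin_cases β <;>
        simp [tensorLLT, hY, hH, Matrix.mul_apply, Fin.sum_univ_succ]
    rw [sum_smul_fiducial, mul_assoc, hQZ, mul_assoc, hYH, fiducial, ← mul_assoc _ b, ← hZb,
      Matrix.smul_mul, smul_smul, inv_mul_cancel₀ ht, one_smul]
    simp only [mul_assoc]

end Pencil

/-! ### Injectivity at length four -/

section Normality

/-- Differences that cancel the identity terms leave equations in `r` and `k` alone, which force `r
= 0`. Then a rank-one matrix is scalar, hence zero, which gives `y = 0` and `x = 0`. -/
theorem eq_zero_of_contraction {r k : Matrix (Fin 2) (Fin 2) ℂ} {x y u v : Fin 2 → ℂ} {ρ : ℂ}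
    (hk : k ≠ 0) (hu : u ≠ 0) (hv : v ≠ 0)
    (h : ∀ a j b l, r l a * k j b + (1 : Matrix (Fin 2) (Fin 2) ℂ) b l * (y a * v j) +
      (1 : Matrix (Fin 2) (Fin 2) ℂ) a j * (u b * x l) +
      ρ * ((1 : Matrix (Fin 2) (Fin 2) ℂ) a j * (1 : Matrix (Fin 2) (Fin 2) ℂ) b l) = 0) :
    r = 0 ∧ x = 0 ∧ y = 0 ∧ ρ = 0 := by
  have hk' : k 0 0 ≠ 0 ∨ k 0 1 ≠ 0 ∨ k 1 0 ≠ 0 ∨ k 1 1 ≠ 0 := by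
    by_contra! h0
    exact hk (by ext i j; fin_cases i <;> fin_cases j <;> simp [h0])
  have hu' : u 0 ≠ 0 ∨ u 1 ≠ 0 := by
    by_contra! h0
    exact hu (by ext i; fin_cases i <;> simp [h0])
  have hv' : v 0 ≠ 0 ∨ v 1 ≠ 0 := by
    by_contra! h0
    exact hv (by ext i; fin_cases i <;> simp [h0])
  have d0 : (1 : Matrix (Fin 2) (Fin 2) ℂ) 0 0 = 1 := rfl
  have d1 : (1 : Matrix (Fin 2) (Fin 2) ℂ) 0 1 = 0 := rfl
  have d2 : (1 : Matrix (Fin 2) (Fin 2) ℂ) 1 0 = 0 := rfl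
  have d3 : (1 : Matrix (Fin 2) (Fin 2) ℂ) 1 1 = 1 := rfl
  simp only [Fin.forall_fin_two, d0, d1, d2, d3, mul_zero, mul_one, zero_mul, one_mul, add_zero]
    at h
  obtain ⟨⟨⟨⟨e0000, e0001⟩, e0010, e0011⟩, ⟨e0100, e0101⟩, e0110, e0111⟩,
    ⟨⟨e1000, e1001⟩, e1010, e1011⟩, ⟨e1100, e1101⟩, e1110, e1111⟩ := h
  have a1 : r 1 0 * k 0 0 = r 1 1 * k 1 0 := by linear_combination e0001 - e1101
  have a2 : r 0 0 * k 0 1 = r 0 1 * k 1 1 := by linear_combination e0010 - e1110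
  have a3 : r 0 0 * k 1 0 = r 1 0 * k 1 1 := by linear_combination e0100 - e0111
  have a4 : r 0 1 * k 0 0 = r 1 1 * k 0 1 := by linear_combination e1000 - e1011
  have a5 : r 0 0 * k 0 0 - r 1 0 * k 0 1 - r 0 1 * k 1 0 + r 1 1 * k 1 1 = 0 := by
    linear_combination e0000 - e0011 - e1100 + e1111
  have hr : r 0 0 = 0 ∧ r 0 1 = 0 ∧ r 1 0 = 0 ∧ r 1 1 = 0 := by
    rcases hk' with h0 | h0 | h0 | h0 <;> grind
  obtain ⟨r00, r01, r10, r11⟩ := hr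
  simp only [r00, r01, r10, zero_mul, zero_add] at e0000 e0011 e0100 e1000 e1100 e0001 e0010
  have hy : y 0 = 0 ∧ y 1 = 0 := by
    have : y 0 * v 0 = y 1 * v 1 := by linear_combination e0000 - e1100
    rcases hv' with h0 | h0 <;> grind
  have hx : x 0 = 0 ∧ x 1 = 0 := by
    have : u 0 * x 0 = u 1 * x 1 := by linear_combination e0000 - e0011
    rcases hu' with h0 | h0 <;> grind
  refine ⟨?_, ?_, ?_, ?_⟩
  · ext i j; fin_cases i <;> fin_cases j <;> simp [r00, r01, r10, r11]
  · ext i; fin_cases i <;> simp [hx]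
  · ext i; fin_cases i <;> simp [hy]
  · linear_combination e0000 - v 0 * hy.1 - u 0 * hx.1

/-- Contracted with the two-site blocks `E i j ⊕ U i j`, joined by the matrix with blocks
`U + v vᵀ`, `v`, `vᵀ`, `1`, only the zero matrix vanishes. -/
theorem eq_zero_of_block_contraction {r U : Matrix (Fin 2) (Fin 2) ℂ} {x y v : Fin 2 → ℂ} {ρ : ℂ}
    (hU : U.det ≠ 0) (hv : v ≠ 0)
    (h : ∀ i j k l, r l i * (U j k + v j * v k) + U k l * (y i * v j) + U i j * (v k * x l) +
      ρ * (U i j * U k l) = 0) :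
    r = 0 ∧ x = 0 ∧ y = 0 ∧ ρ = 0 := by
  have hWU : U⁻¹ * U = 1 := Matrix.nonsing_inv_mul U (isUnit_iff_ne_zero.2 hU)
  have hUW : U * U⁻¹ = 1 := Matrix.mul_nonsing_inv U (isUnit_iff_ne_zero.2 hU)
  set W := U⁻¹ with hW
  have hUWt : Wᵀ * Uᵀ = 1 := by rw [← Matrix.transpose_mul, hUW, Matrix.transpose_one]
  -- Otherwise `U = -v vᵀ` would be singular.
  have hK : U + Matrix.vecMulVec v v ≠ 0 := by
    intro h0
    apply hU
    rw [eq_neg_of_add_eq_zero_left h0]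
    simp [Matrix.det_fin_two, Matrix.vecMulVec_apply]
    ring
  have hK' : (U + Matrix.vecMulVec v v) * Wᵀ ≠ 0 := by
    intro h0
    apply hK
    rw [← mul_one (U + _), ← hUWt, ← mul_assoc, h0, zero_mul]
  have hWv : W *ᵥ v ≠ 0 := by
    intro h0
    apply hv
    rw [← Matrix.one_mulVec v, ← hUW, ← Matrix.mulVec_mulVec, h0, Matrix.mulVec_zero]
  -- Contracting `i` and `k` with `U⁻¹` turns both factors `U` into identities.
  obtain ⟨h1, h2, h3, h4⟩ := eq_zero_of_contraction (r := r * Wᵀ) (x := x) (y := W *ᵥ y)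
    (u := W *ᵥ v) (v := v) (ρ := ρ) hK' hWv hv (by
      intro a j b l
      rw [← hWU]
      simp only [Matrix.mul_apply, Matrix.mulVec, dotProduct, Fin.sum_univ_two,
        Matrix.transpose_apply, Matrix.add_apply, Matrix.vecMulVec_apply]
      linear_combination W a 0 * W b 0 * h 0 j 0 l + W a 0 * W b 1 * h 0 j 1 l +
        W a 1 * W b 0 * h 1 j 0 l + W a 1 * W b 1 * h 1 j 1 l)
  refine ⟨?_, h2, ?_, h4⟩
  · rw [← mul_one r, ← hUWt, ← mul_assoc, h1, zero_mul]
  · rw [← Matrix.one_mulVec y, ← hUW, ← Matrix.mulVec_mulVec, h3, Matrix.mulVec_zero]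

theorem fiducial_injectiveAt_four {b : Matrix (Fin 3) (Fin 3) ℂ} (hb : b.det ≠ 0)
    (hb20 : b 2 0 = 1) (hv : vecV b ≠ 0) : InjectiveAt (fiducial b) 4 := by
  suffices H : ∀ X : Matrix (Fin 3) (Fin 3) ℂ,
      (∀ j : Fin 4 → Fin 2, (X * wordProd (fiducial b) j).trace = 0) → X = 0 by
    intro X Y hXY
    rw [← sub_eq_zero]
    refine H _ fun j => ?_
    rw [sub_mul, Matrix.trace_sub, sub_eq_zero]
    exact congrFun hXY j
  intro X hX
  let P : Matrix (Fin 3) (Fin 3) ℂ := !![b 1 0, b 0 0, 1; 0, 1, 0; 1, 0, 0]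
  let Q : Matrix (Fin 3) (Fin 3) ℂ := !![0, 1, b 2 2; 1, 0, b 2 1; 0, 0, 1]
  let D : Fin 2 → Fin 2 → Matrix (Fin 3) (Fin 3) ℂ := fun i j =>
    ![![!![1, 0, 0; 0, 0, 0; 0, 0, bilinT b 0 0], !![0, 1, 0; 0, 0, 0; 0, 0, bilinT b 0 1]],
      ![!![0, 0, 0; 1, 0, 0; 0, 0, bilinT b 1 0], !![0, 0, 0; 0, 1, 0; 0, 0, bilinT b 1 1]]] i j
  have hD : ∀ i j, tensorLLT i * b * tensorLLT j = P * D i j * Q := by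
    intro i j
    ext α β
    fin_cases i <;> fin_cases j <;> fin_cases α <;> fin_cases β <;>
      simp [tensorLLT, P, Q, D, bilinT, Matrix.mul_apply, Matrix.vecMul, dotProduct,
        Fin.sum_univ_three, hb20]
  let U := bilinT b
  let v := vecV b
  have hK : Q * b * P = !![U 0 0 + v 0 * v 0, U 0 1 + v 0 * v 1, v 0;
      U 1 0 + v 1 * v 0, U 1 1 + v 1 * v 1, v 1; v 0, v 1, 1] := by
    ext α β
    fin_cases α <;> fin_cases β <;>
      simp [P, Q, U, v, bilinT, vecV, Matrix.mul_apply, Matrix.vecMul, dotProduct, Fin.sum_univ_three, hb20] <;> ring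
  let R := Q * X * b * P
  have hR : ∀ i j k l, (R * D i j * (Q * b * P) * D k l).trace = 0 := by
    intro i j k l
    have h1 := hX ![i, j, k, l]
    have h2 : X * wordProd (fiducial b) ![i, j, k, l] =
        X * b * (tensorLLT i * b * tensorLLT j) * b * (tensorLLT k * b * tensorLLT l) := by
      simp [wordProd, fiducial, List.ofFn_succ, mul_assoc]
    rw [h2, hD, hD] at h1
    rw [← h1, ← mul_assoc _ _ Q, Matrix.trace_mul_comm _ Q]
    simp only [R, mul_assoc]
  have hu : Q.det ≠ 0 := by simp [Q, Matrix.det_fin_three]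
  have hp : P.det ≠ 0 := by simp [P, Matrix.det_fin_three]
  have hent : ∀ i j k l : Fin 2, R l.castSucc i.castSucc * (U j k + v j * v k) +
      U k l * (R 2 i.castSucc * v j) + U i j * (v k * R l.castSucc 2) +
      R 2 2 * (U i j * U k l) = 0 := by
    intro i j k l
    have := hR i j k l
    rw [hK] at this
    rw [← this]
    fin_cases i <;> fin_cases j <;> fin_cases k <;> fin_cases l <;>
      simp [D, U, Matrix.trace, Matrix.mul_apply, Fin.sum_univ_three] <;> ring
  obtain ⟨h1, h2, h3, h4⟩ := eq_zero_of_block_contraction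
    (r := Matrix.of fun l i : Fin 2 => R l.castSucc i.castSucc)
    (x := fun l => R l.castSucc 2) (y := fun i => R 2 i.castSucc)
    (by rw [det_bilinT hb20]; exact hb) hv hent
  have hR0 : R = 0 := by
    ext α β
    have r1 := fun l i => congrFun (congrFun h1 l) i
    have r2 := fun l => congrFun h2 l
    have r3 := fun l => congrFun h3 l
    simp only [Fin.forall_fin_two] at r1 r2 r3
    simp at r1 r2 r3
    fin_cases α <;> fin_cases β <;> simp [r1, r2, r3, h4]
  have uQ : IsUnit Q := (Matrix.isUnit_iff_isUnit_det _).2 hu.isUnit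
  have uP : IsUnit P := (Matrix.isUnit_iff_isUnit_det _).2 hp.isUnit
  have ub : IsUnit b := (Matrix.isUnit_iff_isUnit_det _).2 hb.isUnit
  have hR0' : Q * X * b * P = 0 := hR0
  rwa [uP.mul_left_eq_zero, ub.mul_left_eq_zero, uQ.mul_right_eq_zero] at hR0'

end Normality

/-! ### From tensors to states -/

section States

theorem siteProd_ofFn (A : MPSTensor) (k : ℕ) {N : ℕ} (i : Fin N → Fin 2) :
    siteProd (fun _ => A) k (List.ofFn i) = wordProd A i := by
  induction N generalizing k with
  | zero => simp [wordProd]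
  | succ N ih =>
    rw [List.ofFn_succ, siteProd_cons, ih]
    simp [wordProd, List.ofFn_succ]

theorem siteProd_sum_smul_ofFn (A : MPSTensor) (g : ℕ → Matrix (Fin 2) (Fin 2) ℂ) (k : ℕ) {N : ℕ}
    (i : Fin N → Fin 2) :
    siteProd (fun k i => ∑ j, g k i j • A j) k (List.ofFn i) =
      ∑ j : Fin N → Fin 2, (∏ m : Fin N, g (k + m) (i m) (j m)) • wordProd A j := by
  induction N generalizing k with
  | zero => simp [wordProd]
  | succ N ih =>
    rw [List.ofFn_succ, siteProd_cons, ih, ← (Fin.consEquiv fun _ => Fin 2).sum_comp,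
      Fintype.sum_prod_type, Finset.sum_mul]
    refine Finset.sum_congr rfl fun a _ => ?_
    rw [Finset.mul_sum]
    refine Finset.sum_congr rfl fun j _ => ?_
    rw [Fin.prod_univ_succ]
    simp [Fin.consEquiv, wordProd, List.ofFn_succ, smul_smul, add_assoc, add_comm 1, mul_comm]

theorem localOp_mps (A : MPSTensor) {N : ℕ} (g : ℕ → Matrix (Fin 2) (Fin 2) ℂ)
    (i : Fin N → Fin 2) :
    localOp (fun k => g k) (mps A N) i =
      (siteProd (fun k i => ∑ j, g k i j • A j) 0 (List.ofFn i)).trace := by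
  rw [siteProd_sum_smul_ofFn, Matrix.trace_sum]
  simp [localOp, mps]

theorem InjectiveAt.eq_zero {A : MPSTensor} {m : ℕ} (h : InjectiveAt A m) (k : ℕ)
    {X : Matrix (Fin 3) (Fin 3) ℂ}
    (hX : ∀ w : List (Fin 2), w.length = m → (X * siteProd (fun _ => A) k w).trace = 0) :
    X = 0 := by
  refine h (funext fun j => ?_)
  have := hX (List.ofFn j) (by simp)
  rw [siteProd_ofFn] at this
  simpa using this

theorem InjectiveAt.separating {A : MPSTensor} (hA : ∀ X, (∀ i, X * A i = 0) → X = 0) {L : ℕ}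
    (h : InjectiveAt A L) {m : ℕ} (hm : L ≤ m) : Separating (fun _ => A) m := by
  induction m, hm using Nat.le_induction with
  | base => exact fun k X hX => h.eq_zero k hX
  | succ m _ ih =>
    intro k X hX
    refine hA X fun i => ih (k + 1) _ fun w hw => ?_
    simpa [mul_assoc] using hX (i :: w) (by simpa using hw)

/-- Each `A i` is recovered from the transformed tensor through `(g k)⁻¹`, one site at a time. -/
theorem Separating.sum_smul {A : MPSTensor} {m : ℕ} (h : Separating (fun _ => A) m)
    {g : ℕ → Matrix (Fin 2) (Fin 2) ℂ} (hg : ∀ k, (g k).det ≠ 0) :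
    Separating (fun k i => ∑ j, g k i j • A j) m := by
  intro k X hX
  refine h k X ?_
  clear h
  induction m generalizing k X with
  | zero => simpa using hX
  | succ m ih =>
    intro w hw
    cases w with
    | nil => simp at hw
    | cons i w =>
      have hw' : w.length = m := by simpa using hw
      have hi : ∀ i, (X * (∑ j, g k i j • A j) * siteProd (fun _ => A) (k + 1) w).trace = 0 :=
        fun i => ih (k + 1) _ (fun u hu => by
          simpa only [siteProd_cons, mul_assoc] using hX (i :: u) (by simpa using hu)) w hw'
      have hA : A i = ∑ l, (g k)⁻¹ i l • ∑ j, g k l j • A j := by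
        have h1 : (g k)⁻¹ * g k = 1 := Matrix.nonsing_inv_mul _ (hg k).isUnit
        simp only [Finset.smul_sum, smul_smul]
        rw [Finset.sum_comm]
        simp only [← Finset.sum_smul, ← Matrix.mul_apply, h1, Matrix.one_apply, ite_smul,
          one_smul, zero_smul, Finset.sum_ite_eq, Finset.mem_univ, if_true]
      rw [siteProd_cons, ← mul_assoc, hA, Finset.mul_sum, Finset.sum_mul, Matrix.trace_sum]
      refine Finset.sum_eq_zero fun l _ => ?_
      rw [Matrix.mul_smul, Matrix.smul_mul, Matrix.trace_smul, hi, smul_zero]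

theorem eq_zero_of_mul_fiducial {b : Matrix (Fin 3) (Fin 3) ℂ} (hb : IsUnit b)
    (X : Matrix (Fin 3) (Fin 3) ℂ) (h : ∀ i, X * fiducial b i = 0) : X = 0 := by
  have h0 : ∀ i α β, (X * b * tensorLLT i) α β = 0 := fun i α β => by
    rw [mul_assoc]
    exact congrFun (congrFun (h i) α) β
  rw [← hb.mul_left_eq_zero]
  ext α β
  have h1 := h0 1 α 0
  have h2 := h0 1 α 2
  have h3 := h0 0 α 2
  simp only [Matrix.mul_apply (M := X * b), Fin.sum_univ_three] at h1 h2 h3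
  fin_cases β
  · simpa [tensorLLT] using h1
  · simpa [tensorLLT] using h2
  · simpa [tensorLLT] using h3

theorem relatedByGlobal_of_gauge {A C : MPSTensor} {g : Matrix (Fin 2) (Fin 2) ℂ}
    {Z : Matrix (Fin 3) (Fin 3) ℂ} {l : ℂ} (hZ : IsUnit Z) (hl : l ≠ 0)
    (h : ∀ i, (∑ j, g i j • C j) * Z = l • (Z * A i)) (N : ℕ) :
    RelatedByGlobal g (mps A N) (mps C N) := by
  have hw : ∀ (w : List (Fin 2)) (k : ℕ), siteProd (fun _ i => ∑ j, g i j • C j) k w * Z =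
      l ^ w.length • (Z * siteProd (fun _ => A) k w) := by
    intro w
    induction w with
    | nil => simp
    | cons i w ih =>
      intro k
      rw [siteProd_cons, siteProd_cons, mul_assoc, ih, Matrix.mul_smul, ← mul_assoc, h,
        Matrix.smul_mul, smul_smul, List.length_cons, pow_succ, mul_assoc Z]
  obtain ⟨z, rfl⟩ := hZ
  have hloc : localOp (fun _ => g) (mps C N) = l ^ N • mps A N := by
    funext i
    rw [localOp_mps C (fun _ => g)]
    have h1 := hw (List.ofFn i) 0
    rw [List.length_ofFn, siteProd_ofFn A] at h1
    rw [← mul_one (siteProd _ _ _), ← z.mul_inv, ← mul_assoc, h1, Matrix.smul_mul,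
      Matrix.trace_smul, Matrix.trace_mul_comm, Units.inv_mul_cancel_left]
    rfl
  have hlN := pow_ne_zero N hl
  exact ⟨(l ^ N)⁻¹, inv_ne_zero hlN, by rw [hloc, smul_smul, inv_mul_cancel₀ hlN, one_smul]⟩

theorem GloballyEquivalent.sloccEquivalent {N : ℕ} (hN : N ≠ 0) {ψ φ : QubitState N}
    (h : GloballyEquivalent ψ φ) : SLOCCEquivalent ψ φ := by
  obtain ⟨g, μ, hμ, rfl⟩ := h
  -- An `N`-th root of the scalar is absorbed into each local operator.
  obtain ⟨ν, rfl⟩ := IsAlgClosed.exists_pow_nat_eq μ (Nat.pos_of_ne_zero hN)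
  have hν : ν ≠ 0 := by
    rintro rfl
    exact hμ (zero_pow hN)
  have hdet : (ν • (g : Matrix (Fin 2) (Fin 2) ℂ)).det ≠ 0 := by
    rw [Matrix.det_smul]
    exact mul_ne_zero (pow_ne_zero _ hν) (det_ne_zero_of_isUnit g.isUnit)
  refine ⟨fun _ => Matrix.GeneralLinearGroup.mkOfDetNeZero _ hdet, funext fun i => ?_⟩
  change _ = ∑ j, (∏ k, (ν • (g : Matrix (Fin 2) (Fin 2) ℂ)) (i k) (j k)) * φ j
  simp [localOp, Finset.prod_mul_distrib, Finset.mul_sum, mul_assoc]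

theorem ParamRelated.relatedByGlobal {b c : Matrix (Fin 3) (Fin 3) ℂ} (hb20 : b 2 0 = 1)
    (hc20 : c 2 0 = 1) (g : Matrix.SpecialLinearGroup (Fin 2) ℂ)
    (h : ParamRelated b c (g : Matrix (Fin 2) (Fin 2) ℂ)) (N : ℕ) :
    RelatedByGlobal (g : Matrix (Fin 2) (Fin 2) ℂ) (mps (fiducial b) N) (mps (fiducial c) N) := by
  obtain ⟨Z, l, hZ, hl, hgauge⟩ := exists_gauge_of_paramRelated hb20 hc20 g.det_coe h
  exact relatedByGlobal_of_gauge hZ hl hgauge N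

theorem SLOCCEquivalent.exists_paramRelated {b c : Matrix (Fin 3) (Fin 3) ℂ}
    (hb : IsUnit b) (hc : IsUnit c) (hb20 : b 2 0 = 1) (hc20 : c 2 0 = 1)
    (hvb : vecV b ≠ 0) (hvc : vecV c ≠ 0) {L N : ℕ}
    (hLb : InjectiveAt (fiducial b) L) (hLc : InjectiveAt (fiducial c) L) (hN : 2 * L + 1 ≤ N)
    (h : SLOCCEquivalent (mps (fiducial b) N) (mps (fiducial c) N)) :
    ∃ g : Matrix.SpecialLinearGroup (Fin 2) ℂ,
      ParamRelated b c (g : Matrix (Fin 2) (Fin 2) ℂ) := by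
  obtain ⟨g, hg⟩ := h
  have hN0 : 0 < N := by omega
  let G : ℕ → Matrix (Fin 2) (Fin 2) ℂ := fun k => g ⟨k % N, Nat.mod_lt k hN0⟩
  have hG : ∀ k : Fin N, G k = g k := fun k => by
    simp only [G, Nat.mod_eq_of_lt k.2]
  have hGN : ∀ k, G (k + N) = G k := fun k => by simp only [G, Nat.add_mod_right]
  have hGdet : ∀ k, (G k).det ≠ 0 := fun k => det_ne_zero_of_isUnit (g _).isUnit
  have hsb := fun m (hm : L ≤ m) => hLb.separating (eq_zero_of_mul_fiducial hb) hm
  have hsc := fun m (hm : L ≤ m) =>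
    (hLc.separating (eq_zero_of_mul_fiducial hc) hm).sum_smul hGdet
  obtain ⟨Z, hZ, hgauge⟩ := exists_gauge hN (fun _ => rfl) (fun k => by simp only [hGN]) hsb hsc
    (by
      intro w hw
      subst hw
      have h1 := congrFun hg w.get
      have h2 := localOp_mps (fiducial c) G w.get
      simp only [hG] at h2
      rw [h2, List.ofFn_get, mps, ← siteProd_ofFn _ 0, List.ofFn_get] at h1
      exact h1)
  -- The gauge relation is available from site `L` on, so the ring is relabelled to start there.
  choose l hl hlZ using fun k => hgauge (L + k) (Nat.le_add_right L k)
  exact paramRelated_of_gauge hN0.ne' (det_ne_zero_of_isUnit hb) (det_ne_zero_of_isUnit hc)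
    hb20 hc20 hvb hvc (g := fun k => G (L + k)) (fun k => hGdet _)
    (fun k => by rw [← add_assoc, hGN]) (Z := fun k => Z (L + k)) (fun k => hZ _) hl hlZ

theorem paramRelated_iff_ratioRelated {b c g : Matrix _ _ ℂ} (hv : vecV b ⬝ᵥ vecV b ≠ 0) :
    ParamRelated b c g ↔ RatioRelated b c g := by
  have hsq : ∀ t : ℂ, vecV b = t • (g *ᵥ vecV c) →
      (vecV b ⬝ᵥ vecV b) / ((g *ᵥ vecV c) ⬝ᵥ (g *ᵥ vecV c)) = t ^ 2 := by
    intro t ht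
    rw [ht, smul_dotProduct, dotProduct_smul, smul_smul, smul_eq_mul] at hv ⊢
    rw [mul_div_assoc, div_self (right_ne_zero_of_mul hv), mul_one, sq]
  constructor
  · rintro ⟨t, ht, h1, h2⟩
    exact ⟨⟨t, ht, h1⟩, by rw [hsq t h1, h2]⟩
  · rintro ⟨⟨t, ht, h1⟩, h2⟩
    exact ⟨t, ht, h1, by rw [h2, hsq t h1]⟩

end States

theorem mainTheorem1 (b c : Matrix (Fin 3) (Fin 3) ℂ)
    (hb : IsUnit b) (hc : IsUnit c)
    (hb20 : b 2 0 = 1) (hc20 : c 2 0 = 1)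
    (hvb : vecV b ≠ 0) (hvc : vecV c ≠ 0) :
    (IsNormalTensor (fiducial b) ∧ IsNormalTensor (fiducial c)) ∧
    (∀ L : ℕ, InjectiveAt (fiducial b) L → InjectiveAt (fiducial c) L →
      (∀ N : ℕ, 2 * L + 1 ≤ N →
        (SLOCCEquivalent (mps (fiducial b) N) (mps (fiducial c) N) ↔
          GloballyEquivalent (mps (fiducial b) N) (mps (fiducial c) N)) ∧
        (SLOCCEquivalent (mps (fiducial b) N) (mps (fiducial c) N) ↔
          ∃ g : Matrix.SpecialLinearGroup (Fin 2) ℂ,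
            ParamRelated b c (g : Matrix (Fin 2) (Fin 2) ℂ)) ∧
        (∀ g : Matrix.SpecialLinearGroup (Fin 2) ℂ,
          ParamRelated b c (g : Matrix (Fin 2) (Fin 2) ℂ) →
            RelatedByGlobal (g : Matrix (Fin 2) (Fin 2) ℂ)
              (mps (fiducial b) N) (mps (fiducial c) N))) ∧
      (∀ N N' : ℕ, 2 * L + 1 ≤ N → 2 * L + 1 ≤ N' →
        (SLOCCEquivalent (mps (fiducial b) N) (mps (fiducial c) N) ↔
          SLOCCEquivalent (mps (fiducial b) N') (mps (fiducial c) N')))) ∧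
    (vecV b ⬝ᵥ vecV b ≠ 0 →
      ∀ g : Matrix.SpecialLinearGroup (Fin 2) ℂ,
        (ParamRelated b c (g : Matrix (Fin 2) (Fin 2) ℂ) ↔
          RatioRelated b c (g : Matrix (Fin 2) (Fin 2) ℂ))) := by
  refine ⟨⟨⟨4, fiducial_injectiveAt_four (det_ne_zero_of_isUnit hb) hb20 hvb⟩,
    ⟨4, fiducial_injectiveAt_four (det_ne_zero_of_isUnit hc) hc20 hvc⟩⟩, fun L hLb hLc => ?_,
    fun hv g => paramRelated_iff_ratioRelated hv⟩
  have hparam : ∀ N, 2 * L + 1 ≤ N → SLOCCEquivalent (mps (fiducial b) N) (mps (fiducial c) N) →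
      ∃ g : Matrix.SpecialLinearGroup (Fin 2) ℂ,
        ParamRelated b c (g : Matrix (Fin 2) (Fin 2) ℂ) := fun N hN h =>
    h.exists_paramRelated hb hc hb20 hc20 hvb hvc hLb hLc hN
  have hglobal : ∀ N, (∃ g : Matrix.SpecialLinearGroup (Fin 2) ℂ,
      ParamRelated b c (g : Matrix (Fin 2) (Fin 2) ℂ)) →
      GloballyEquivalent (mps (fiducial b) N) (mps (fiducial c) N) := fun N ⟨g, hg⟩ =>
    ⟨(g : GL (Fin 2) ℂ), hg.relatedByGlobal hb20 hc20 g N⟩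
  have hslocc : ∀ N, 2 * L + 1 ≤ N → GloballyEquivalent (mps (fiducial b) N) (mps (fiducial c) N) →
      SLOCCEquivalent (mps (fiducial b) N) (mps (fiducial c) N) := fun N hN h =>
    h.sloccEquivalent (by omega)
  exact ⟨fun N hN => ⟨⟨fun h => hglobal N (hparam N hN h), hslocc N hN⟩,
      ⟨hparam N hN, fun h => hslocc N hN (hglobal N h)⟩,
      fun g hg => hg.relatedByGlobal hb20 hc20 g N⟩,
    fun N N' hN hN' => ⟨fun h => hslocc N' hN' (hglobal N' (hparam N hN h)),
      fun h => hslocc N hN (hglobal N (hparam N' hN' h))⟩⟩
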